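/- Let $\mathcal C$ be an abelian category. A class means a class of objects of $\mathcal C$; $\operatorname{Ext}^k$ denotes the (Yoneda) extension groups of $\mathcal C$, and dimensions take values in $\{0,1,2,\dots\}\cup\{\infty\}$, with $\inf\emptyset=\infty$ and $\sup\emptyset=0$. **Notation.** For classes $\mathcal Z,\mathcal T,\mathcal Y,\mathcal W$: - $\mathcal Z^{\perp}$ (resp. ${}^{\perp}\mathcal Z$) is the class of all $N$ with $\operatorname{Ext}^i(Z,N)=0$ (resp. $\operatorname{Ext}^i(N,Z)=0$) for all $i\ge 1$ and all $Z\in\mathcal Z$. - $\operatorname{pd}_{\mathcal T}(M)$ (resp. $\operatorname{id}_{\mathcal T}(M)$) is the least $n\ge 0$ such that $\operatorname{Ext}^k(M,T)=0$ (resp. $\operatorname{Ext}^k(T,M)=0$) for all $k>n$ and all $T\in\mathcal T$; $\operatorname{pd}_{\mathcal T}(\mathcal Z)=\sup_{Z\in\mathcal Z}\operatorname{pd}_{\mathcal T}(Z)$ and $\operatorname{id}_{\mathcal T}(\mathcal Z)=\sup_{Z\in\mathcal Z}\operatorname{id}_{\mathcal T}(Z)$. - A $\mathcal Y_{\mathcal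 W}$-coresolution of length $n$ of $M$ is an exact sequence $0\to M\xrightarrow{f_0}Y_0\xrightarrow{f_1}Y_1\to\cdots\xrightarrow{f_n}Y_n\to 0$ with $Y_n\in\mathcal W\cap\mathcal Y$, $Y_k\in\mathcal Y$ for $0\le k\le n-1$, and $\operatorname{Im}f_i\in\mathcal W$ for $1\le i\le n-1$. The least such $n$ is $\operatorname{coresdim}^{\mathcal W}_{\mathcal Y}(M)$, and $\operatorname{coresdim}^{\mathcal W}_{\mathcal Y}(\mathcal Z)=\sup_{Z\in\mathcal Z}\operatorname{coresdim}^{\mathcal W}_{\mathcal Y}(Z)$. The class of objects having a $\mathcal Y_{\mathcal W}$-coresolution of some finite length is $\mathcal Y_{\mathcal W}^{\vee}$, and $(\mathcal W,\mathcal Y)^{\vee}=\mathcal W\cap\mathcal Y_{\mathcal W}^{\vee}$. Dually, with exact sequences $0\to Y_n\to\cdots\to Y_0\to M\to 0$, one defines $\operatorname{resdim}^{\mathcal W}_{\mathcal Y}$, $\mathcal Y_{\mathcal W}^{\wedge}$ and $(\mathcal Y,\mathcal W)^{\wedge}=\mathcal Y_{\mathcal W}^{\wedge}\cap\mathcal W$.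 The symbol $\mathcal W$ is omitted when $\mathcal W=\mathcal C$. A pair $(\mathcal A,\mathcal B)$ is *$\mathcal X$-complete* if every $X\in\mathcal X$ admits exact sequences $0\to B\to A\to X\to 0$ and $0\to X\to B'\to A'\to 0$ with $A,A'\in\mathcal A\cap\mathcal X$ and $B,B'\in\mathcal B\cap\mathcal X$; it is *$\mathcal X$-hereditary* if $\operatorname{id}_{\mathcal A\cap\mathcal X}(\mathcal B\cap\mathcal X)=0$. **Theorem.** Let $\mathcal X,\mathcal A,\mathcal B$ be classes of objects of $\mathcal C$, each closed under extensions and direct summands, such that $(\mathcal A,\mathcal B)$ is $\mathcal X$-complete and $\mathcal X$-hereditary, and let $\omega=\mathcal A\cap\mathcal B\cap\mathcal X$. Then: (a) $\omega=(\mathcal A\cap\mathcal X)^{\perp}\cap\mathcal A\cap\mathcal X=\mathcal A\cap\mathcal X\cap\omega^{\wedge}=(\omega,\mathcal A\cap\mathcal X)^{\wedge}$. (a1) $$\begin{aligned}\operatorname{pd}_{\mathcal X}(\mathcal A\cap\mathcal X)&=\operatorname{pd}_{\mathcal A\cap\mathcal X}(\mathcal A\cap\mathcal X)=\operatorname{coresdim}_{\mathcal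 B\cap\mathcal X}(\mathcal A\cap\mathcal X)=\operatorname{coresdim}^{\mathcal X}_{\mathcal B}(\mathcal X)=\operatorname{coresdim}^{\mathcal X}_{\mathcal B}(\mathcal A\cap\mathcal X)\\&=\operatorname{coresdim}_{\omega}(\mathcal A\cap\mathcal X)=\operatorname{coresdim}^{\mathcal X}_{\mathcal B\cap\mathcal X}(\mathcal A\cap\mathcal X)=\operatorname{coresdim}^{\mathcal X}_{\mathcal B\cap\mathcal X}(\mathcal X).\end{aligned}$$ (a2) $\operatorname{pd}_{\mathcal A\cap\mathcal X}(\mathcal A\cap\mathcal X)<\infty$ if and only if $\mathcal A\cap\mathcal X\subseteq\omega^{\vee}$ and $\operatorname{pd}_{\mathcal X}(\omega)<\infty$. Moreover, if $\operatorname{pd}_{\mathcal A\cap\mathcal X}(\mathcal A\cap\mathcal X)<\infty$, then $\mathcal X\subseteq(\mathcal X,\mathcal B)^{\vee}\subseteq(\mathcal B\cap\mathcal X)^{\vee}$ and $\operatorname{pd}_{\mathcal X}(\mathcal A\cap\mathcal X)=\operatorname{pd}_{\mathcal X}(\omega)$. (b) $\omega={}^{\perp}(\mathcal B\cap\mathcal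 X)\cap\mathcal B\cap\mathcal X=\mathcal B\cap\mathcal X\cap\omega^{\vee}=(\mathcal B\cap\mathcal X,\omega)^{\vee}$. (b1) $$\begin{aligned}\operatorname{id}_{\mathcal X}(\mathcal B\cap\mathcal X)&=\operatorname{id}_{\mathcal B\cap\mathcal X}(\mathcal B\cap\mathcal X)=\operatorname{resdim}_{\mathcal A\cap\mathcal X}(\mathcal B\cap\mathcal X)=\operatorname{resdim}^{\mathcal X}_{\mathcal A}(\mathcal X)=\operatorname{resdim}^{\mathcal X}_{\mathcal A}(\mathcal B\cap\mathcal X)\\&=\operatorname{resdim}_{\omega}(\mathcal B\cap\mathcal X)=\operatorname{resdim}^{\mathcal X}_{\mathcal A\cap\mathcal X}(\mathcal B\cap\mathcal X)=\operatorname{resdim}^{\mathcal X}_{\mathcal A\cap\mathcal X}(\mathcal X).\end{aligned}$$ (b2) $\operatorname{id}_{\mathcal B\cap\mathcal X}(\mathcal B\cap\mathcal X)<\infty$ if and only if $\mathcal B\cap\mathcal X\subseteq\omega^{\wedge}$ and $\operatorname{id}_{\mathcal X}(\omega)<\infty$. Moreover, if $\operatorname{id}_{\mathcal B\cap\mathcal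 X}(\mathcal B\cap\mathcal X)<\infty$, then $\mathcal X\subseteq(\mathcal A,\mathcal X)^{\wedge}\subseteq(\mathcal A\cap\mathcal X)^{\wedge}$ and $\operatorname{id}_{\mathcal X}(\mathcal B\cap\mathcal X)=\operatorname{id}_{\mathcal X}(\omega)$. -/

import Mathlib

open CategoryTheory CategoryTheory.Limits

universe v u

namespace RelHomAlg

variable {C : Type u} [Category.{v} C] [Abelian C]

/-- `Ext^k(M, N) = 0`. The Ext-groups of an arbitrary abelian category are formed here in the
universe `max u v`, in which they always exist. -/
def ExtVanishes (M N : C) (k : ℕ) : Prop :=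
  letI : HasExt.{max u v} C := HasExt.standard C
  Subsingleton (Abelian.Ext.{max u v} M N k)

/-- The class of all `N` such that `Ext^i(M, N) = 0` for all `M` in `𝒵` and all `i > 0`. -/
def rightPerp (𝒵 : ObjectProperty C) : ObjectProperty C :=
  fun N => ∀ i : ℕ, 0 < i → ∀ M : C, 𝒵 M → ExtVanishes M N i

/-- The class of all `M` such that `Ext^i(M, N) = 0` for all `N` in `𝒵` and all `i > 0`. -/
def leftPerp (𝒵 : ObjectProperty C) : ObjectProperty C :=
  fun M => ∀ i : ℕ, 0 < i → ∀ N : C, 𝒵 N → ExtVanishes M N i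

/-- The `𝒯`-projective dimension of `M`: the least natural number `n` such that
`Ext^k(M, T) = 0` for all `k > n` and all `T` in `𝒯`, and `⊤` if there is none. -/
noncomputable def pdObj (𝒯 : ObjectProperty C) (M : C) : ℕ∞ :=
  ⨅ (n : ℕ) (_ : ∀ k : ℕ, n < k → ∀ T : C, 𝒯 T → ExtVanishes M T k), (n : ℕ∞)

/-- The `𝒯`-injective dimension of `M`: the least natural number `n` such that
`Ext^k(T, M) = 0` for all `k > n` and all `T` in `𝒯`, and `⊤` if there is none. -/
noncomputable def idObj (𝒯 : ObjectProperty C) (M : C) : ℕ∞ :=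
  ⨅ (n : ℕ) (_ : ∀ k : ℕ, n < k → ∀ T : C, 𝒯 T → ExtVanishes T M k), (n : ℕ∞)

/-- The `𝒯`-projective dimension of the class `𝒵`. -/
noncomputable def projd (𝒯 𝒵 : ObjectProperty C) : ℕ∞ :=
  ⨆ (M : C) (_ : 𝒵 M), pdObj 𝒯 M

/-- The `𝒯`-injective dimension of the class `𝒵`. -/
noncomputable def injd (𝒯 𝒵 : ObjectProperty C) : ℕ∞ :=
  ⨆ (M : C) (_ : 𝒵 M), idObj 𝒯 M

/-- A `𝒴_𝒳`-coresolution of length `n` of `M`: an exact sequence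
`0 ⟶ M ⟶ Y₀ ⟶ Y₁ ⟶ ⋯ ⟶ Yₙ ⟶ 0` (continued by zero objects), with maps
`ι : M ⟶ Y₀` and `d i : Yᵢ ⟶ Yᵢ₊₁`, such that `Yₖ` is in `𝒴` for `k < n`, `Yₙ` is in
`𝒳 ∩ 𝒴` and the images of the maps `Yᵢ ⟶ Yᵢ₊₁` are in `𝒳` whenever `i + 1 < n`. -/
structure Coresolution (𝒴 𝒳 : ObjectProperty C) (M : C) (n : ℕ) where
  obj : ℕ → C
  ι : M ⟶ obj 0
  d : ∀ i : ℕ, obj i ⟶ obj (i + 1)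
  mono_ι : Mono ι
  ι_d : ι ≫ d 0 = 0
  d_d : ∀ i : ℕ, d i ≫ d (i + 1) = 0
  exact_zero : (ShortComplex.mk ι (d 0) ι_d).Exact
  exact_succ : ∀ i : ℕ, (ShortComplex.mk (d i) (d (i + 1)) (d_d i)).Exact
  isZero_obj : ∀ i : ℕ, n < i → IsZero (obj i)
  obj_mem : ∀ k : ℕ, k < n → 𝒴 (obj k)
  last_mem : (𝒳 ⊓ 𝒴) (obj n)
  image_mem : ∀ i : ℕ, i + 1 < n → 𝒳 (image (d i))

/-- A `𝒴_𝒳`-resolution of length `n` of `M`: an exact sequence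
`0 ⟶ Yₙ ⟶ ⋯ ⟶ Y₁ ⟶ Y₀ ⟶ M ⟶ 0` (continued by zero objects), with maps
`π : Y₀ ⟶ M` and `d i : Yᵢ₊₁ ⟶ Yᵢ`, such that `Yₖ` is in `𝒴` for `k < n`, `Yₙ` is in
`𝒳 ∩ 𝒴` and the images of the maps `Yᵢ₊₁ ⟶ Yᵢ` are in `𝒳` whenever `i + 1 < n`. -/
structure Resolution (𝒴 𝒳 : ObjectProperty C) (M : C) (n : ℕ) where
  obj : ℕ → C
  π : obj 0 ⟶ M
  d : ∀ i : ℕ, obj (i + 1) ⟶ obj i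
  epi_π : Epi π
  d_π : d 0 ≫ π = 0
  d_d : ∀ i : ℕ, d (i + 1) ≫ d i = 0
  exact_zero : (ShortComplex.mk (d 0) π d_π).Exact
  exact_succ : ∀ i : ℕ, (ShortComplex.mk (d (i + 1)) (d i) (d_d i)).Exact
  isZero_obj : ∀ i : ℕ, n < i → IsZero (obj i)
  obj_mem : ∀ k : ℕ, k < n → 𝒴 (obj k)
  last_mem : (𝒳 ⊓ 𝒴) (obj n)
  image_mem : ∀ i : ℕ, i + 1 < n → 𝒳 (image (d i))

/-- The `𝒴_𝒳`-coresolution dimension of `M`. -/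
noncomputable def coresdimObj (𝒴 𝒳 : ObjectProperty C) (M : C) : ℕ∞ :=
  ⨅ (n : ℕ) (_ : Nonempty (Coresolution 𝒴 𝒳 M n)), (n : ℕ∞)

/-- The `𝒴_𝒳`-resolution dimension of `M`. -/
noncomputable def resdimObj (𝒴 𝒳 : ObjectProperty C) (M : C) : ℕ∞ :=
  ⨅ (n : ℕ) (_ : Nonempty (Resolution 𝒴 𝒳 M n)), (n : ℕ∞)

/-- `coresdimRel 𝒴 𝒳 𝒵` is the `𝒴_𝒳`-coresolution dimension of the class `𝒵`. -/
noncomputable def coresdimRel (𝒴 𝒳 𝒵 : ObjectProperty C) : ℕ∞ :=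
  ⨆ (M : C) (_ : 𝒵 M), coresdimObj 𝒴 𝒳 M

/-- `resdimRel 𝒴 𝒳 𝒵` is the `𝒴_𝒳`-resolution dimension of the class `𝒵`. -/
noncomputable def resdimRel (𝒴 𝒳 𝒵 : ObjectProperty C) : ℕ∞ :=
  ⨆ (M : C) (_ : 𝒵 M), resdimObj 𝒴 𝒳 M

/-- The absolute `𝒴`-coresolution dimension of the class `𝒵`. -/
noncomputable def coresdim (𝒴 𝒵 : ObjectProperty C) : ℕ∞ := coresdimRel 𝒴 ⊤ 𝒵

/-- The absolute `𝒴`-resolution dimension of the class `𝒵`. -/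
noncomputable def resdim (𝒴 𝒵 : ObjectProperty C) : ℕ∞ := resdimRel 𝒴 ⊤ 𝒵

/-- The class of the objects with a finite `𝒴_𝒳`-coresolution. -/
def veeRel (𝒴 𝒳 : ObjectProperty C) : ObjectProperty C :=
  fun M => ∃ n : ℕ, Nonempty (Coresolution 𝒴 𝒳 M n)

/-- The class of the objects with a finite `𝒴_𝒳`-resolution. -/
def wedgeRel (𝒴 𝒳 : ObjectProperty C) : ObjectProperty C :=
  fun M => ∃ n : ℕ, Nonempty (Resolution 𝒴 𝒳 M n)

/-- The class `𝒴^∨`. -/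
def vee (𝒴 : ObjectProperty C) : ObjectProperty C := veeRel 𝒴 ⊤

/-- The class `𝒴^∧`. -/
def wedge (𝒴 : ObjectProperty C) : ObjectProperty C := wedgeRel 𝒴 ⊤

/-- The class `(𝒳, 𝒴)^∨ = 𝒳 ∩ 𝒴_𝒳^∨`. -/
def pairVee (𝒳 𝒴 : ObjectProperty C) : ObjectProperty C := 𝒳 ⊓ veeRel 𝒴 𝒳

/-- The class `(𝒴, 𝒳)^∧ = 𝒴_𝒳^∧ ∩ 𝒳`. -/
def pairWedge (𝒴 𝒳 : ObjectProperty C) : ObjectProperty C := wedgeRel 𝒴 𝒳 ⊓ 𝒳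

/-- Every `M` in `𝒳` admits an exact sequence `0 ⟶ B ⟶ A ⟶ M ⟶ 0` with `A` in `𝒜 ∩ 𝒳` and
`B` in `ℬ ∩ 𝒳`. -/
def LeftComplete (𝒳 𝒜 ℬ : ObjectProperty C) : Prop :=
  ∀ M : C, 𝒳 M → ∃ (A B : C) (f : B ⟶ A) (g : A ⟶ M) (w : f ≫ g = 0),
    (ShortComplex.mk f g w).ShortExact ∧ (𝒜 ⊓ 𝒳) A ∧ (ℬ ⊓ 𝒳) B

/-- Every `M` in `𝒳` admits an exact sequence `0 ⟶ M ⟶ B ⟶ A ⟶ 0` with `A` in `𝒜 ∩ 𝒳` and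
`B` in `ℬ ∩ 𝒳`. -/
def RightComplete (𝒳 𝒜 ℬ : ObjectProperty C) : Prop :=
  ∀ M : C, 𝒳 M → ∃ (A B : C) (f : M ⟶ B) (g : B ⟶ A) (w : f ≫ g = 0),
    (ShortComplex.mk f g w).ShortExact ∧ (𝒜 ⊓ 𝒳) A ∧ (ℬ ⊓ 𝒳) B

/-- The pair `(𝒜, ℬ)` is `𝒳`-complete. -/
def IsComplete (𝒳 𝒜 ℬ : ObjectProperty C) : Prop :=
  LeftComplete 𝒳 𝒜 ℬ ∧ RightComplete 𝒳 𝒜 ℬ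

/-- The pair `(𝒜, ℬ)` is `𝒳`-hereditary. -/
def IsHereditary (𝒳 𝒜 ℬ : ObjectProperty C) : Prop :=
  injd (𝒜 ⊓ 𝒳) (ℬ ⊓ 𝒳) = 0

/-- `𝒵` is closed under direct summands: every direct summand (up to isomorphism) of an object
of `𝒵` is in `𝒵`. -/
def ClosedUnderSummands (𝒵 : ObjectProperty C) : Prop :=
  ∀ M N Z : C, 𝒵 Z → Nonempty (Z ≅ M ⊞ N) → 𝒵 M

end RelHomAlg

/-!
As `ℬ` is closed under summands, an object `M` of `𝒳` with `Ext¹(𝒜 ∩ 𝒳, M) = 0` lies in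
`ℬ`: the sequence `0 ⟶ M ⟶ B ⟶ A ⟶ 0` provided by completeness splits. Iterating these
sequences and shifting dimensions along them, a bound on the degrees in which `Ext(𝒜 ∩ 𝒳, M)` is
nonzero yields a coresolution of that length of `M` by objects of `ℬ`; for `M` in `𝒜 ∩ 𝒳` its
terms stay in `𝒜 ∩ 𝒳`, hence lie in `ω`. Conversely, by the hereditary property, a coresolution
by objects of `ℬ` bounds these degrees, and a coresolution by `ω` bounds the projective dimension
by that of `ω`.

The statements on resolutions and injective dimensions are those on coresolutions and projective
dimensions in the opposite category. This rests on `Ext^k(M, N)` in `C` being in bijection with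
`Ext^k(N, M)` in `Cᵒᵖ`. As morphisms in derived categories these groups are matched by reversing
complexes, which identifies the localization at the quasi-isomorphisms of the complexes of `Cᵒᵖ`
with the opposite of the one for `C`.
-/

open Opposite

open scoped ZeroObject

namespace RelHomAlg

variable {C : Type u} [Category.{v} C] [Abelian C]

/-! ### Duality for extension groups -/

lemma quasiIso_opEquivalence_functor_map_iff {K L : CochainComplex C ℤ} (f : K ⟶ L) :
    QuasiIso ((CochainComplex.opEquivalence C).functor.map f.op) ↔ QuasiIso f := by
  have quasiIsoAt_iff (n : ℤ) :
      QuasiIsoAt ((CochainComplex.opEquivalence C).functor.map f.op) n ↔ QuasiIsoAt f (-n) := by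
    rw [quasiIsoAt_iff' _ (n - 1) n (n + 1) (by simp) (by simp),
      quasiIsoAt_iff' _ (-(n + 1)) (-n) (-(n - 1)) (by simp; lia) (by simp; lia)]
    exact ShortComplex.quasiIso_opMap_iff
      ((HomologicalComplex.shortComplexFunctor' C (.up ℤ) (-(n + 1)) (-n) (-(n - 1))).map f)
  simp only [quasiIso_iff, quasiIsoAt_iff]
  exact (Equiv.neg ℤ).forall_congr_right (q := fun n => QuasiIsoAt f n)

lemma inverseImage_quasiIso_opEquivalence :
    (HomologicalComplex.quasiIso Cᵒᵖ (.up ℤ)).inverseImage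
      (CochainComplex.opEquivalence C).functor = (HomologicalComplex.quasiIso C (.up ℤ)).op := by
  ext K L f
  exact quasiIso_opEquivalence_functor_map_iff f.unop

instance [HasDerivedCategory Cᵒᵖ] :
    ((CochainComplex.opEquivalence C).functor ⋙ DerivedCategory.Q).IsLocalization
      (HomologicalComplex.quasiIso C (.up ℤ)).op := by
  rw [← inverseImage_quasiIso_opEquivalence]
  let Φ : LocalizerMorphism ((HomologicalComplex.quasiIso Cᵒᵖ (.up ℤ)).inverseImage
      (CochainComplex.opEquivalence C).functor) (HomologicalComplex.quasiIso Cᵒᵖ (.up ℤ)) :=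
    { functor := (CochainComplex.opEquivalence C).functor
      map := le_rfl }
  have : Φ.functor.IsEquivalence := (CochainComplex.opEquivalence C).isEquivalence_functor
  have : Φ.IsLocalizedEquivalence := .of_equivalence Φ
    (MorphismProperty.map_inverseImage_eq_of_isEquivalence ..).ge
  exact LocalizerMorphism.IsLocalizedEquivalence.isLocalization Φ DerivedCategory.Q

lemma nonempty_iso_single_of_isStrictlyGE_of_isStrictlyLE (K : CochainComplex C ℤ) (n : ℤ)
    [K.IsStrictlyGE n] [K.IsStrictlyLE n] {A : C} (e : K.X n ≅ A) :
    Nonempty (K ≅ (HomologicalComplex.single C (.up ℤ) n).obj A) := by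
  obtain ⟨M, ⟨f⟩⟩ := K.exists_iso_single n
  let g : M ≅ A := (HomologicalComplex.singleObjXSelf (.up ℤ) n M).symm ≪≫
    (HomologicalComplex.eval C (.up ℤ) n).mapIso f.symm ≪≫ e
  exact ⟨f ≪≫ (HomologicalComplex.single C (.up ℤ) n).mapIso g⟩

lemma nonempty_iso_single_op (A : C) (n : ℤ) :
    Nonempty ((CochainComplex.opEquivalence C).functor.obj
      (op ((HomologicalComplex.single C (.up ℤ) (-n)).obj A)) ≅
        (HomologicalComplex.single Cᵒᵖ (.up ℤ) n).obj (op A)) := by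
  let K := (CochainComplex.opEquivalence C).functor.obj
      (op ((HomologicalComplex.single C (.up ℤ) (-n)).obj A))
  have isZero_X (i : ℤ) (hi : i ≠ n) : IsZero (K.X i) :=
    (HomologicalComplex.isZero_single_obj_X (.up ℤ) (-n) A (-i) (by simpa using hi)).op
  have : K.IsStrictlyGE n := K.isStrictlyGE_iff n |>.2 fun i hi => isZero_X i hi.ne
  have : K.IsStrictlyLE n := K.isStrictlyLE_iff n |>.2 fun i hi => isZero_X i hi.ne'
  exact nonempty_iso_single_of_isStrictlyGE_of_isStrictlyLE K n
    (HomologicalComplex.singleObjXSelf (.up ℤ) (-n) A).op.symm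

/-- `Ext^k(M, N)` as the group of morphisms `M[-m] ⟶ N[-n]` of the derived category, for any
integers with `n + k = m`: this frees the position of `M` and `N`, which passing to the opposite
category changes. -/
noncomputable def extEquivSingleHom [HasExt C] [HasDerivedCategory C] (M N : C) (k : ℕ) (m n : ℤ)
    (h : n + k = m) :
    Abelian.Ext M N k ≃ ((DerivedCategory.singleFunctor C m).obj M ⟶
      (DerivedCategory.singleFunctor C n).obj N) :=
  Abelian.Ext.homEquiv.trans <|
    ((((DerivedCategory.singleFunctors C).shiftIso m 0 m (by simp)).app M).homCongr
      (((DerivedCategory.singleFunctors C).shiftIso m (-k) n (by lia)).app N ≪≫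
        ((DerivedCategory.singleFunctors C).shiftIso (k : ℤ) (-k) 0 (by simp)).symm.app N)).symm
      |>.trans
        (Functor.FullyFaithful.ofFullyFaithful (shiftFunctor (DerivedCategory C) m)).homEquiv.symm

lemma nonempty_ext_equiv_ext_op [HasExt C] [HasExt Cᵒᵖ] (M N : C) (k : ℕ) :
    Nonempty (Abelian.Ext M N k ≃ Abelian.Ext (op N) (op M) k) := by
  let := HasDerivedCategory.standard C
  let := HasDerivedCategory.standard Cᵒᵖ
  obtain ⟨eM⟩ := nonempty_iso_single_op M 0
  obtain ⟨eN⟩ := nonempty_iso_single_op N k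
  exact ⟨calc
    Abelian.Ext M N k ≃ _ := extEquivSingleHom M N k (-0) (-k) (by simp)
    _ ≃ _ := (opEquiv _ _).symm
    _ ≃ _ := Localization.homEquiv (HomologicalComplex.quasiIso C (.up ℤ)).op
      DerivedCategory.Q.op ((CochainComplex.opEquivalence C).functor ⋙ DerivedCategory.Q)
    _ ≃ _ := (DerivedCategory.Q.mapIso eN).homCongr (DerivedCategory.Q.mapIso eM)
    _ ≃ Abelian.Ext (op N) (op M) k := (extEquivSingleHom (op N) (op M) k k 0 (by simp)).symm⟩

/-! ### Vanishing of extension groups -/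

lemma extVanishes_op_iff {M N : C} {k : ℕ} :
    ExtVanishes (op N) (op M) k ↔ ExtVanishes M N k := by
  let : HasExt.{max u v} C := HasExt.standard C
  let : HasExt.{max u v} Cᵒᵖ := HasExt.standard Cᵒᵖ
  obtain ⟨e⟩ := nonempty_ext_equiv_ext_op M N k
  exact e.symm.subsingleton_congr

namespace ExtVanishes

lemma of_forall_eq_zero {M N : C} {k : ℕ}
    (h : letI : HasExt.{max u v} C := HasExt.standard C
      ∀ x : Abelian.Ext.{max u v} M N k, x = 0) : ExtVanishes M N k :=
  let : HasExt.{max u v} C := HasExt.standard C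
  subsingleton_of_forall_eq 0 h

variable {S : ShortComplex C} {T : C} {k : ℕ}

lemma X₁_of_X₂_of_X₃ (hS : S.ShortExact) (h₂ : ExtVanishes T S.X₂ (k + 1))
    (h₃ : ExtVanishes T S.X₃ k) : ExtVanishes T S.X₁ (k + 1) := by
  let : HasExt.{max u v} C := HasExt.standard C
  refine .of_forall_eq_zero fun x => ?_
  obtain ⟨y, rfl⟩ := Abelian.Ext.covariant_sequence_exact₁ _ hS x (h₂.elim _ _) rfl
  rw [h₃.elim y 0, Abelian.Ext.zero_comp]

lemma X₃_of_X₁_of_X₂ (hS : S.ShortExact) (h₁ : ExtVanishes T S.X₁ (k + 1))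
    (h₂ : ExtVanishes T S.X₂ k) : ExtVanishes T S.X₃ k := by
  let : HasExt.{max u v} C := HasExt.standard C
  refine .of_forall_eq_zero fun x => ?_
  obtain ⟨y, rfl⟩ := Abelian.Ext.covariant_sequence_exact₃ _ hS x rfl (h₁.elim _ _)
  rw [h₂.elim y 0, Abelian.Ext.zero_comp]

lemma left_X₁_of_X₂_of_X₃ (hS : S.ShortExact) (h₂ : ExtVanishes S.X₂ T k)
    (h₃ : ExtVanishes S.X₃ T (k + 1)) : ExtVanishes S.X₁ T k :=
  extVanishes_op_iff.1 <|
    X₃_of_X₁_of_X₂ hS.op (extVanishes_op_iff.2 h₃) (extVanishes_op_iff.2 h₂)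

lemma nonempty_iso_biprod (hS : S.ShortExact) (h : ExtVanishes S.X₃ S.X₁ 1) :
    Nonempty (S.X₂ ≅ S.X₁ ⊞ S.X₃) := by
  let : HasExt.{max u v} C := HasExt.standard C
  obtain ⟨y, hy⟩ := Abelian.Ext.covariant_sequence_exact₃ _ hS (Abelian.Ext.mk₀ (𝟙 S.X₃))
    (zero_add 1) (h.elim _ _)
  obtain ⟨s, rfl⟩ := Abelian.Ext.homEquiv₀.symm.surjective y
  have hs : s ≫ S.g = 𝟙 _ := Abelian.Ext.homEquiv₀.symm.injective (by simpa using hy)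
  exact ⟨(ShortComplex.Splitting.ofExactOfSection S hS.exact s hs hS.mono_f).isoBinaryBiproduct⟩

end ExtVanishes

/-! ### Closure properties of classes -/

section

variable {𝒵 𝒲 : ObjectProperty C}

lemma ClosedUnderSummands.isClosedUnderIsomorphisms (h : ClosedUnderSummands 𝒵) :
    𝒵.IsClosedUnderIsomorphisms where
  of_iso e hX := h _ 0 _ hX ⟨e ≪≫ isoBiprodZero (isZero_zero C)⟩

instance [𝒵.IsClosedUnderExtensions] [𝒲.IsClosedUnderExtensions] :
    (𝒵 ⊓ 𝒲).IsClosedUnderExtensions where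
  prop_X₂_of_shortExact hS h₁ h₃ :=
    ⟨𝒵.prop_X₂_of_shortExact hS h₁.1 h₃.1, 𝒲.prop_X₂_of_shortExact hS h₁.2 h₃.2⟩

instance [𝒵.IsClosedUnderExtensions] : 𝒵.op.IsClosedUnderExtensions where
  prop_X₂_of_shortExact hS h₁ h₃ := 𝒵.prop_X₂_of_shortExact hS.unop h₃ h₁

end

/-! ### Coresolutions -/

section

variable {𝒴 𝒳 𝒴' 𝒳' : ObjectProperty C} {M : C} {n : ℕ}

namespace Coresolution

/-- The coresolution of length `0` of an object. -/
noncomputable def ofMem (hM : (𝒳 ⊓ 𝒴) M) : Coresolution 𝒴 𝒳 M 0 where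
  obj | 0 => M | _ + 1 => 0
  ι := 𝟙 M
  d _ := 0
  mono_ι := inferInstance
  ι_d := comp_zero
  d_d _ := comp_zero
  exact_zero := ShortComplex.exact_iff_epi _ rfl |>.2 inferInstance
  exact_succ _ := ShortComplex.exact_of_isZero_X₂ _ (isZero_zero C)
  isZero_obj
    | _ + 1, _ => isZero_zero C
  obj_mem _ h := absurd h (Nat.not_lt_zero _)
  last_mem := hM
  image_mem _ h := absurd h (Nat.not_lt_zero _)

/-- Splicing a short exact sequence `0 ⟶ M ⟶ Y ⟶ N ⟶ 0` with a coresolution of `N`. -/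
def cons [𝒳.IsClosedUnderIsomorphisms] {Y N : C} {f : M ⟶ Y} {g : Y ⟶ N} {w : f ≫ g = 0}
    (hS : (ShortComplex.mk f g w).ShortExact) (hY : 𝒴 Y) (hN : 𝒳 N)
    (R : Coresolution 𝒴 𝒳 N n) : Coresolution 𝒴 𝒳 M (n + 1) where
  obj | 0 => Y | i + 1 => R.obj i
  ι := f
  d | 0 => g ≫ R.ι | i + 1 => R.d i
  mono_ι := hS.mono_f
  ι_d := by rw [reassoc_of% w, zero_comp]
  d_d
    | 0 => by simp [R.ι_d]
    | i + 1 => R.d_d i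
  exact_zero := by
    have := R.mono_ι
    let φ : ShortComplex.mk f g w ⟶
        ShortComplex.mk f (g ≫ R.ι) (by rw [reassoc_of% w, zero_comp]) :=
      { τ₁ := 𝟙 _, τ₂ := 𝟙 _, τ₃ := R.ι }
    exact (ShortComplex.exact_iff_of_epi_of_isIso_of_mono φ).1 hS.exact
  exact_succ
    | 0 => by
      have : Epi g := hS.epi_g
      let φ : ShortComplex.mk (g ≫ R.ι) (R.d 0) (by simp [R.ι_d]) ⟶
          ShortComplex.mk R.ι (R.d 0) R.ι_d :=
        { τ₁ := g, τ₂ := 𝟙 _, τ₃ := 𝟙 _ }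
      exact (ShortComplex.exact_iff_of_epi_of_isIso_of_mono φ).2 R.exact_zero
    | i + 1 => R.exact_succ i
  isZero_obj
    | i + 1, h => R.isZero_obj i (Nat.lt_of_succ_lt_succ h)
  obj_mem
    | 0, _ => hY
    | k + 1, h => R.obj_mem k (Nat.lt_of_succ_lt_succ h)
  last_mem := R.last_mem
  image_mem
    | 0, _ => by
      have : Epi g := hS.epi_g
      have := R.mono_ι
      have := strongEpi_of_epi g
      exact 𝒳.prop_of_iso (image.isoStrongEpiMono g R.ι rfl) hN
    | i + 1, h => R.image_mem i (Nat.lt_of_succ_lt_succ h)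

/-- The coresolution of the first cosyzygy. -/
noncomputable def tail (R : Coresolution 𝒴 𝒳 M (n + 1)) :
    Coresolution 𝒴 𝒳 (image (R.d 0)) n where
  obj i := R.obj (i + 1)
  ι := image.ι (R.d 0)
  d i := R.d (i + 1)
  mono_ι := inferInstance
  ι_d := by
    rw [← cancel_epi (factorThruImage (R.d 0)), image.fac_assoc, R.d_d, comp_zero]
  d_d i := R.d_d (i + 1)
  exact_zero := by
    have w : image.ι (R.d 0) ≫ R.d 1 = 0 := by
      rw [← cancel_epi (factorThruImage (R.d 0)), image.fac_assoc, R.d_d, comp_zero]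
    let φ : ShortComplex.mk (R.d 0) (R.d 1) (R.d_d 0) ⟶
        ShortComplex.mk (image.ι (R.d 0)) (R.d 1) w :=
      { τ₁ := factorThruImage (R.d 0), τ₂ := 𝟙 _, τ₃ := 𝟙 _ }
    exact (ShortComplex.exact_iff_of_epi_of_isIso_of_mono φ).1 (R.exact_succ 0)
  exact_succ i := R.exact_succ (i + 1)
  isZero_obj i h := R.isZero_obj (i + 1) (Nat.succ_lt_succ h)
  obj_mem k h := R.obj_mem (k + 1) (Nat.succ_lt_succ h)
  last_mem := R.last_mem
  image_mem i h := R.image_mem (i + 1) (Nat.succ_lt_succ h)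

/-- The same coresolution, seen relative to larger classes. -/
def ofLE (hY : 𝒴 ≤ 𝒴') (hX : 𝒳 ≤ 𝒳') (R : Coresolution 𝒴 𝒳 M n) : Coresolution 𝒴' 𝒳' M n :=
  { R with
    obj_mem := fun k hk => hY _ (R.obj_mem k hk)
    last_mem := ⟨hX _ R.last_mem.1, hY _ R.last_mem.2⟩
    image_mem := fun i hi => hX _ (R.image_mem i hi) }

lemma mem [𝒴.IsClosedUnderIsomorphisms] [𝒳.IsClosedUnderIsomorphisms]
    (R : Coresolution 𝒴 𝒳 M 0) : (𝒳 ⊓ 𝒴) M := by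
  have := R.mono_ι
  have : Epi R.ι := R.exact_zero.epi_f ((R.isZero_obj 1 Nat.one_pos).eq_of_tgt _ _)
  have := isIso_of_mono_of_epi R.ι
  exact (𝒳 ⊓ 𝒴).prop_of_iso (asIso R.ι).symm R.last_mem

lemma shortExact (R : Coresolution 𝒴 𝒳 M n) :
    ∃ w : R.ι ≫ factorThruImage (R.d 0) = 0,
      (ShortComplex.mk R.ι (factorThruImage (R.d 0)) w).ShortExact := by
  have w : R.ι ≫ factorThruImage (R.d 0) = 0 := by
    rw [← cancel_mono (image.ι (R.d 0)), Category.assoc, image.fac, R.ι_d, zero_comp]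
  let φ : ShortComplex.mk R.ι (factorThruImage (R.d 0)) w ⟶ ShortComplex.mk R.ι (R.d 0) R.ι_d :=
    { τ₁ := 𝟙 _, τ₂ := 𝟙 _, τ₃ := image.ι (R.d 0) }
  have := R.mono_ι
  exact ⟨w, ⟨(ShortComplex.exact_iff_of_epi_of_isIso_of_mono φ).2 R.exact_zero⟩⟩

variable [𝒴.IsClosedUnderIsomorphisms] [𝒳.IsClosedUnderIsomorphisms]

lemma extVanishes {T : C} (hT : ∀ Y, 𝒴 Y → ∀ k, 0 < k → ExtVanishes T Y k)
    (R : Coresolution 𝒴 𝒳 M n) {k : ℕ} (hk : n < k) : ExtVanishes T M k := by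
  induction n generalizing M k with
  | zero => exact hT M R.mem.2 k hk
  | succ n ih =>
    obtain ⟨k, rfl⟩ := Nat.exists_eq_add_one_of_ne_zero (Nat.ne_zero_of_lt hk)
    obtain ⟨w, hS⟩ := R.shortExact
    exact .X₁_of_X₂_of_X₃ hS (hT _ (R.obj_mem 0 n.succ_pos) _ k.succ_pos)
      (ih R.tail (Nat.lt_of_succ_lt_succ hk))

lemma left_extVanishes {T : C} {m : ℕ} (hT : ∀ Y, 𝒴 Y → ∀ k, m < k → ExtVanishes Y T k)
    (R : Coresolution 𝒴 𝒳 M n) {k : ℕ} (hk : m < k) : ExtVanishes M T k := by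
  induction n generalizing M k with
  | zero => exact hT M R.mem.2 k hk
  | succ n ih =>
    obtain ⟨w, hS⟩ := R.shortExact
    exact .left_X₁_of_X₂_of_X₃ hS (hT _ (R.obj_mem 0 n.succ_pos) _ hk)
      (ih R.tail (hk.trans k.lt_succ_self))

lemma image_mem_zero (R : Coresolution 𝒴 𝒳 M (n + 1)) : 𝒳 (image (R.d 0)) := by
  cases n with
  | zero => exact R.tail.mem.1
  | succ n => exact R.image_mem 0 (by lia)

lemma nonempty_inf [𝒳.IsClosedUnderExtensions] (hM : 𝒳 M) (R : Coresolution 𝒴 𝒳 M n) :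
    Nonempty (Coresolution (𝒴 ⊓ 𝒳) 𝒳 M n) := by
  induction n generalizing M with
  | zero => exact ⟨.ofMem ⟨hM, R.mem.2, hM⟩⟩
  | succ n ih =>
    obtain ⟨w, hS⟩ := R.shortExact
    have obj_zero_mem : 𝒳 (R.obj 0) := 𝒳.prop_X₂_of_shortExact hS hM R.image_mem_zero
    obtain ⟨R'⟩ := ih R.image_mem_zero R.tail
    exact ⟨R'.cons hS ⟨R.obj_mem 0 n.succ_pos, obj_zero_mem⟩ R.image_mem_zero⟩

end Coresolution

variable [𝒳.IsClosedUnderIsomorphisms]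

/-- The coresolution in the opposite category given by a resolution. -/
protected noncomputable def Resolution.op (R : Resolution 𝒴 𝒳 M n) :
    Coresolution 𝒴.op 𝒳.op (op M) n where
  obj i := op (R.obj i)
  ι := R.π.op
  d i := (R.d i).op
  mono_ι := have := R.epi_π; inferInstance
  ι_d := by rw [← op_comp, R.d_π, op_zero]
  d_d i := by rw [← op_comp, R.d_d, op_zero]
  exact_zero := R.exact_zero.op
  exact_succ i := (R.exact_succ i).op
  isZero_obj i hi := (R.isZero_obj i hi).op
  obj_mem := R.obj_mem
  last_mem := R.last_mem
  image_mem i hi := 𝒳.op.prop_of_iso (imageOpOp (R.d i)) (R.image_mem i hi)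

/-- The resolution given by a coresolution in the opposite category. -/
protected noncomputable def Coresolution.unop (R : Coresolution 𝒴.op 𝒳.op (op M) n) :
    Resolution 𝒴 𝒳 M n where
  obj i := (R.obj i).unop
  π := R.ι.unop
  d i := (R.d i).unop
  epi_π := have := R.mono_ι; inferInstance
  d_π := by rw [← unop_comp, R.ι_d, unop_zero]
  d_d i := by rw [← unop_comp, R.d_d, unop_zero]
  exact_zero := R.exact_zero.unop
  exact_succ i := (R.exact_succ i).unop
  isZero_obj i hi := (R.isZero_obj i hi).unop
  obj_mem := R.obj_mem
  last_mem := R.last_mem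
  image_mem i hi := 𝒳.prop_of_iso (imageUnopUnop (R.d i)) (R.image_mem i hi)

lemma nonempty_coresolution_op_iff :
    Nonempty (Coresolution 𝒴.op 𝒳.op (op M) n) ↔ Nonempty (Resolution 𝒴 𝒳 M n) :=
  ⟨fun ⟨R⟩ => ⟨R.unop⟩, fun ⟨R⟩ => ⟨R.op⟩⟩

end

/-! ### Homological dimensions -/

lemma iInf_natCast_le_natCast_iff {P : ℕ → Prop} {n : ℕ} :
    (⨅ (m : ℕ) (_ : P m), (m : ℕ∞)) ≤ n ↔ ∃ m ≤ n, P m := by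
  constructor
  · intro h
    by_contra! hP
    have : ((n + 1 : ℕ) : ℕ∞) ≤ ⨅ (m : ℕ) (_ : P m), (m : ℕ∞) :=
      le_iInf₂ fun m hm => Nat.cast_le.2 (by by_contra hlt; exact hP m (by lia) hm)
    have := Nat.cast_le.1 (this.trans h)
    lia
  · rintro ⟨m, hm, hP⟩
    exact (iInf₂_le m hP).trans (Nat.cast_le.2 hm)

lemma le_of_forall_le_natCast {a b : ℕ∞} (h : ∀ n : ℕ, b ≤ n → a ≤ n) : a ≤ b :=
  WithTop.forall_le_coe_iff_le.1 h

lemma projd_le_iff {𝒯 𝒵 : ObjectProperty C} {n : ℕ} :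
    projd 𝒯 𝒵 ≤ n ↔ ∀ M, 𝒵 M → ∀ k, n < k → ∀ T, 𝒯 T → ExtVanishes M T k := by
  simp only [projd, iSup_le_iff, pdObj, iInf_natCast_le_natCast_iff]
  exact forall₂_congr fun M _ => ⟨fun ⟨m, hm, h⟩ k hk => h k (hm.trans_lt hk),
    fun h => ⟨n, le_rfl, h⟩⟩

lemma injd_le_iff {𝒯 𝒵 : ObjectProperty C} {n : ℕ} :
    injd 𝒯 𝒵 ≤ n ↔ ∀ M, 𝒵 M → ∀ k, n < k → ∀ T, 𝒯 T → ExtVanishes T M k := by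
  simp only [injd, iSup_le_iff, idObj, iInf_natCast_le_natCast_iff]
  exact forall₂_congr fun M _ => ⟨fun ⟨m, hm, h⟩ k hk => h k (hm.trans_lt hk),
    fun h => ⟨n, le_rfl, h⟩⟩

lemma coresdimRel_le_iff {𝒴 𝒳 𝒵 : ObjectProperty C} {n : ℕ} :
    coresdimRel 𝒴 𝒳 𝒵 ≤ n ↔ ∀ M, 𝒵 M → ∃ m ≤ n, Nonempty (Coresolution 𝒴 𝒳 M m) := by
  simp only [coresdimRel, iSup_le_iff, coresdimObj, iInf_natCast_le_natCast_iff]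

section

variable {𝒴 𝒳 𝒯 𝒵 𝒴' 𝒳' 𝒯' 𝒵' : ObjectProperty C}

lemma coresdimRel_le_coresdimRel (hY : 𝒴 ≤ 𝒴') (hX : 𝒳 ≤ 𝒳') (hZ : 𝒵 ≤ 𝒵') :
    coresdimRel 𝒴' 𝒳' 𝒵 ≤ coresdimRel 𝒴 𝒳 𝒵' :=
  le_of_forall_le_natCast fun _ hn => coresdimRel_le_iff.2 fun M hM =>
    let ⟨m, hm, ⟨R⟩⟩ := coresdimRel_le_iff.1 hn M (hZ _ hM)
    ⟨m, hm, ⟨R.ofLE hY hX⟩⟩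

lemma projd_mono (hT : 𝒯 ≤ 𝒯') (hZ : 𝒵 ≤ 𝒵') : projd 𝒯 𝒵 ≤ projd 𝒯' 𝒵' :=
  le_of_forall_le_natCast fun _ hn => projd_le_iff.2 fun M hM k hk T hT' =>
    projd_le_iff.1 hn M (hZ _ hM) k hk T (hT _ hT')

lemma le_veeRel_of_coresdimRel_lt_top (hf : coresdimRel 𝒴 𝒳 𝒵 < ⊤) : 𝒵 ≤ veeRel 𝒴 𝒳 := by
  obtain ⟨n, hn⟩ := ENat.ne_top_iff_exists.1 hf.ne
  intro M hM
  obtain ⟨m, -, hR⟩ := coresdimRel_le_iff.1 hn.ge M hM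
  exact ⟨m, hR⟩

lemma projd_le_projd_of_le_veeRel [𝒴.IsClosedUnderIsomorphisms] [𝒳.IsClosedUnderIsomorphisms]
    (hZ : 𝒵 ≤ veeRel 𝒴 𝒳) : projd 𝒯 𝒵 ≤ projd 𝒯 𝒴 :=
  le_of_forall_le_natCast fun _ hn => projd_le_iff.2 fun M hM _ hk T hT =>
    let ⟨_, ⟨R⟩⟩ := hZ M hM
    R.left_extVanishes (fun Y hY k hk => projd_le_iff.1 hn Y hY k hk T hT) hk

lemma pairVee_le_vee : pairVee 𝒳 𝒴 ≤ vee 𝒴 :=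
  fun _ ⟨_, n, ⟨R⟩⟩ => ⟨n, ⟨R.ofLE le_rfl le_top⟩⟩

variable [𝒴.IsClosedUnderIsomorphisms] [𝒳.IsClosedUnderIsomorphisms]
  [𝒳.IsClosedUnderExtensions]

lemma coresdimRel_inf (hZ : 𝒵 ≤ 𝒳) : coresdimRel (𝒴 ⊓ 𝒳) 𝒳 𝒵 = coresdimRel 𝒴 𝒳 𝒵 :=
  le_antisymm
    (le_of_forall_le_natCast fun _ hn => coresdimRel_le_iff.2 fun M hM =>
      let ⟨m, hm, ⟨R⟩⟩ := coresdimRel_le_iff.1 hn M hM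
      ⟨m, hm, R.nonempty_inf (hZ _ hM)⟩)
    (coresdimRel_le_coresdimRel inf_le_left le_rfl le_rfl)

lemma pairVee_inf : pairVee 𝒳 (𝒴 ⊓ 𝒳) = pairVee 𝒳 𝒴 :=
  le_antisymm (fun _ ⟨hM, n, ⟨R⟩⟩ => ⟨hM, n, ⟨R.ofLE inf_le_left le_rfl⟩⟩)
    fun _ ⟨hM, n, ⟨R⟩⟩ => ⟨hM, n, R.nonempty_inf hM⟩

end

/-! ### Passing to the opposite category -/

section

variable {𝒴 𝒳 𝒯 𝒵 : ObjectProperty C}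

lemma leftPerp_op : leftPerp 𝒵.op = (rightPerp 𝒵).op := by
  ext M
  exact forall₂_congr fun k _ =>
    ⟨fun h N hN => extVanishes_op_iff.1 (h (op N) hN), fun h N hN => extVanishes_op_iff.2 (h _ hN)⟩

lemma projd_op : projd 𝒯.op 𝒵.op = injd 𝒯 𝒵 :=
  le_antisymm
    (le_of_forall_le_natCast fun _ hn => projd_le_iff.2 fun _ hM k hk _ hT =>
      extVanishes_op_iff.2 (injd_le_iff.1 hn _ hM k hk _ hT))
    (le_of_forall_le_natCast fun _ hn => injd_le_iff.2 fun M hM k hk T hT =>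
      extVanishes_op_iff.1 (projd_le_iff.1 hn (op M) hM k hk (op T) hT))

variable [𝒳.IsClosedUnderIsomorphisms]

lemma coresdimObj_op (M : C) : coresdimObj 𝒴.op 𝒳.op (op M) = resdimObj 𝒴 𝒳 M := by
  simp only [coresdimObj, resdimObj, nonempty_coresolution_op_iff]

lemma coresdimRel_op : coresdimRel 𝒴.op 𝒳.op 𝒵.op = resdimRel 𝒴 𝒳 𝒵 :=
  (op_surjective.iSup_comp _).symm.trans <|
    iSup_congr fun M => iSup_congr fun _ => coresdimObj_op M

lemma coresdim_op : coresdim 𝒴.op 𝒵.op = resdim 𝒴 𝒵 :=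
  coresdimRel_op (𝒳 := ⊤)

lemma veeRel_op : veeRel 𝒴.op 𝒳.op = (wedgeRel 𝒴 𝒳).op := by
  ext M
  exact exists_congr fun n => nonempty_coresolution_op_iff

lemma vee_op : vee 𝒴.op = (wedge 𝒴).op :=
  veeRel_op (𝒳 := ⊤)

lemma pairVee_op : pairVee 𝒳.op 𝒴.op = (pairWedge 𝒴 𝒳).op := by
  rw [pairVee, pairWedge, veeRel_op, ObjectProperty.op_inf, inf_comm]

end

section

variable {𝒴 𝒳 𝒵 : ObjectProperty C} [𝒳.IsClosedUnderIsomorphisms]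

lemma pairWedge_le_wedge : pairWedge 𝒴 𝒳 ≤ wedge 𝒴 := by
  simpa only [pairVee_op, vee_op, ObjectProperty.op_monotone_iff] using
    pairVee_le_vee (𝒳 := 𝒳.op) (𝒴 := 𝒴.op)

variable [𝒴.IsClosedUnderIsomorphisms] [𝒳.IsClosedUnderExtensions]

lemma resdimRel_inf (hZ : 𝒵 ≤ 𝒳) : resdimRel (𝒴 ⊓ 𝒳) 𝒳 𝒵 = resdimRel 𝒴 𝒳 𝒵 := by
  simpa only [coresdimRel_op, ← ObjectProperty.op_inf] using
    coresdimRel_inf (𝒴 := 𝒴.op) (ObjectProperty.op_monotone_iff.2 hZ)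

lemma pairWedge_inf : pairWedge (𝒴 ⊓ 𝒳) 𝒳 = pairWedge 𝒴 𝒳 := by
  simpa only [pairVee_op, ← ObjectProperty.op_inf, ObjectProperty.op_injective_iff] using
    pairVee_inf (𝒳 := 𝒳.op) (𝒴 := 𝒴.op)

end

/-! ### Complete hereditary pairs -/

/-- Subclasses `𝒜` and `ℬ` of `𝒳`, closed under extensions and under direct summands in `𝒳`,
forming a pair complete and hereditary relative to `𝒳`. -/
structure IsCompleteHereditaryPair (𝒳 𝒜 ℬ : ObjectProperty C) : Prop where
  left_le : 𝒜 ≤ 𝒳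
  right_le : ℬ ≤ 𝒳
  isClosedUnderIsomorphisms : 𝒳.IsClosedUnderIsomorphisms
  isClosedUnderExtensions : 𝒳.IsClosedUnderExtensions
  isClosedUnderExtensions_left : 𝒜.IsClosedUnderExtensions
  isClosedUnderExtensions_right : ℬ.IsClosedUnderExtensions
  left_of_iso_biprod {M N A : C} (hM : 𝒳 M) (hA : 𝒜 A) (e : A ≅ M ⊞ N) : 𝒜 M
  right_of_iso_biprod {M N B : C} (hM : 𝒳 M) (hB : ℬ B) (e : B ≅ M ⊞ N) : ℬ M
  extVanishes {A B : C} (hA : 𝒜 A) (hB : ℬ B) {k : ℕ} (hk : 0 < k) : ExtVanishes A B k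
  exists_left {M : C} (hM : 𝒳 M) : ∃ (A B : C) (f : B ⟶ A) (g : A ⟶ M) (w : f ≫ g = 0),
    (ShortComplex.mk f g w).ShortExact ∧ 𝒜 A ∧ ℬ B
  exists_right {M : C} (hM : 𝒳 M) : ∃ (A B : C) (f : M ⟶ B) (g : B ⟶ A) (w : f ≫ g = 0),
    (ShortComplex.mk f g w).ShortExact ∧ 𝒜 A ∧ ℬ B

variable {𝒳 𝒜 ℬ 𝒴 𝒲 𝒵 : ObjectProperty C}

lemma IsComplete.isCompleteHereditaryPair [𝒳.IsClosedUnderIsomorphisms]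
    [𝒳.IsClosedUnderExtensions] [𝒜.IsClosedUnderExtensions] [ℬ.IsClosedUnderExtensions]
    (hc : IsComplete 𝒳 𝒜 ℬ) (hh : IsHereditary 𝒳 𝒜 ℬ)
    (hA : ClosedUnderSummands 𝒜) (hB : ClosedUnderSummands ℬ) :
    IsCompleteHereditaryPair 𝒳 (𝒜 ⊓ 𝒳) (ℬ ⊓ 𝒳) where
  left_le := inf_le_right
  right_le := inf_le_right
  isClosedUnderIsomorphisms := inferInstance
  isClosedUnderExtensions := inferInstance
  isClosedUnderExtensions_left := inferInstance
  isClosedUnderExtensions_right := inferInstance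
  left_of_iso_biprod hM hZ e := ⟨hA _ _ _ hZ.1 ⟨e⟩, hM⟩
  right_of_iso_biprod hM hZ e := ⟨hB _ _ _ hZ.1 ⟨e⟩, hM⟩
  extVanishes hM hN k hk := (injd_le_iff (n := 0)).1 hh.le _ hN k hk _ hM
  exists_left hM := hc.1 _ hM
  exists_right hM := hc.2 _ hM

namespace IsCompleteHereditaryPair

protected lemma op (h : IsCompleteHereditaryPair 𝒳 𝒜 ℬ) :
    IsCompleteHereditaryPair 𝒳.op ℬ.op 𝒜.op where
  left_le := ObjectProperty.op_monotone_iff.2 h.right_le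
  right_le := ObjectProperty.op_monotone_iff.2 h.left_le
  isClosedUnderIsomorphisms := have := h.isClosedUnderIsomorphisms; inferInstance
  isClosedUnderExtensions := have := h.isClosedUnderExtensions; inferInstance
  isClosedUnderExtensions_left := have := h.isClosedUnderExtensions_right; inferInstance
  isClosedUnderExtensions_right := have := h.isClosedUnderExtensions_left; inferInstance
  left_of_iso_biprod hM hB e :=
    h.right_of_iso_biprod hM hB (e ≪≫ (biprod.opIso _ _).symm).unop.symm
  right_of_iso_biprod hM hA e :=
    h.left_of_iso_biprod hM hA (e ≪≫ (biprod.opIso _ _).symm).unop.symm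
  extVanishes hB hA _ hk := extVanishes_op_iff.2 (h.extVanishes hA hB hk)
  exists_left hM :=
    let ⟨A, B, f, g, w, hS, hA, hB⟩ := h.exists_right hM
    ⟨op B, op A, g.op, f.op, by rw [← op_comp, w, op_zero], hS.op, hB, hA⟩
  exists_right hM :=
    let ⟨A, B, f, g, w, hS, hA, hB⟩ := h.exists_left hM
    ⟨op B, op A, g.op, f.op, by rw [← op_comp, w, op_zero], hS.op, hB, hA⟩

lemma isClosedUnderIsomorphisms_left (h : IsCompleteHereditaryPair 𝒳 𝒜 ℬ) :
    𝒜.IsClosedUnderIsomorphisms where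
  of_iso e hA :=
    have := h.isClosedUnderIsomorphisms
    h.left_of_iso_biprod (𝒳.prop_of_iso e (h.left_le _ hA)) hA
      (e ≪≫ isoBiprodZero (isZero_zero C))

lemma isClosedUnderIsomorphisms_right (h : IsCompleteHereditaryPair 𝒳 𝒜 ℬ) :
    ℬ.IsClosedUnderIsomorphisms where
  of_iso e hB := h.op.isClosedUnderIsomorphisms_left.of_iso e.symm.op hB

lemma right_of_extVanishes (h : IsCompleteHereditaryPair 𝒳 𝒜 ℬ) {M : C} (hM : 𝒳 M)
    (hv : ∀ A, 𝒜 A → ExtVanishes A M 1) : ℬ M := by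
  obtain ⟨A, B, f, g, w, hS, hA, hB⟩ := h.exists_right hM
  obtain ⟨e⟩ := ExtVanishes.nonempty_iso_biprod hS (hv A hA)
  exact h.right_of_iso_biprod hM hB e

lemma left_of_extVanishes (h : IsCompleteHereditaryPair 𝒳 𝒜 ℬ) {M : C} (hM : 𝒳 M)
    (hv : ∀ B, ℬ B → ExtVanishes M B 1) : 𝒜 M :=
  h.op.right_of_extVanishes (M := op M) hM fun _ hB => extVanishes_op_iff.2 (hv _ hB)

lemma inf_eq_leftPerp_inf (h : IsCompleteHereditaryPair 𝒳 𝒜 ℬ) :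
    𝒜 ⊓ ℬ = leftPerp ℬ ⊓ ℬ :=
  le_antisymm (fun _ hM => ⟨fun _ hk _ hB => h.extVanishes hM.1 hB hk, hM.2⟩)
    fun _ hM => ⟨h.left_of_extVanishes (h.right_le _ hM.2) (hM.1 1 one_pos), hM.2⟩

lemma inf_eq_inf_veeRel (h : IsCompleteHereditaryPair 𝒳 𝒜 ℬ) [𝒵.IsClosedUnderIsomorphisms]
    (hZ : ℬ ≤ 𝒵) : 𝒜 ⊓ ℬ = ℬ ⊓ veeRel (𝒜 ⊓ ℬ) 𝒵 := by
  have := h.isClosedUnderIsomorphisms_left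
  have := h.isClosedUnderIsomorphisms_right
  refine le_antisymm (fun M hM => ⟨hM.2, 0, ⟨.ofMem ⟨hZ _ hM.2, hM⟩⟩⟩) ?_
  rintro M ⟨hM, n, ⟨R⟩⟩
  exact ⟨h.left_of_extVanishes (h.right_le _ hM) fun B hB =>
    R.left_extVanishes (fun _ hY _ => h.extVanishes hY.1 hB) one_pos, hM⟩

lemma projd_eq_projd_self (h : IsCompleteHereditaryPair 𝒳 𝒜 ℬ) : projd 𝒳 𝒜 = projd 𝒜 𝒜 := by
  refine le_antisymm (le_of_forall_le_natCast fun n hn => projd_le_iff.2 fun M hM k hk T hT => ?_)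
    (projd_mono h.left_le le_rfl)
  obtain ⟨A, B, f, g, w, hS, hA, hB⟩ := h.exists_left hT
  exact .X₃_of_X₁_of_X₂ hS (h.extVanishes hM hB k.succ_pos) (projd_le_iff.1 hn M hM k hk A hA)

lemma projd_le_coresdimRel (h : IsCompleteHereditaryPair 𝒳 𝒜 ℬ) (hY : 𝒴 ≤ ℬ) (hZ : 𝒜 ≤ 𝒵) :
    projd 𝒳 𝒜 ≤ coresdimRel 𝒴 𝒲 𝒵 := by
  have := h.isClosedUnderIsomorphisms_right
  rw [h.projd_eq_projd_self]
  refine le_of_forall_le_natCast fun n hn => projd_le_iff.2 fun A hA k hk T hT => ?_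
  obtain ⟨m, hm, ⟨R⟩⟩ := coresdimRel_le_iff.1 hn T (hZ _ hT)
  exact (R.ofLE hY le_top).extVanishes (fun _ hB _ => h.extVanishes hA hB) (hm.trans_lt hk)

lemma nonempty_coresolution (h : IsCompleteHereditaryPair 𝒳 𝒜 ℬ)
    [𝒵.IsClosedUnderIsomorphisms] [𝒵.IsClosedUnderExtensions] (hA : 𝒜 ≤ 𝒵) (hX : 𝒵 ≤ 𝒳)
    {n : ℕ} {M : C} (hM : 𝒵 M) (hv : ∀ T, 𝒜 T → ∀ k, n < k → ExtVanishes T M k) :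
    Nonempty (Coresolution (ℬ ⊓ 𝒵) 𝒵 M n) := by
  induction n generalizing M with
  | zero =>
    exact ⟨.ofMem ⟨hM, h.right_of_extVanishes (hX _ hM) fun T hT => hv T hT 1 one_pos, hM⟩⟩
  | succ n ih =>
    obtain ⟨A, B, f, g, w, hS, hA', hB⟩ := h.exists_right (hX _ hM)
    obtain ⟨R⟩ := ih (hA _ hA') fun T hT k hk => .X₃_of_X₁_of_X₂ hS
      (hv T hT _ (Nat.succ_lt_succ hk)) (h.extVanishes hT hB (Nat.zero_lt_of_lt hk))
    exact ⟨R.cons hS ⟨hB, 𝒵.prop_X₂_of_shortExact hS hM (hA _ hA')⟩ (hA _ hA')⟩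

lemma coresdimRel_inf_le_projd (h : IsCompleteHereditaryPair 𝒳 𝒜 ℬ)
    [𝒵.IsClosedUnderIsomorphisms] [𝒵.IsClosedUnderExtensions] (hA : 𝒜 ≤ 𝒵) (hX : 𝒵 ≤ 𝒳) :
    coresdimRel (ℬ ⊓ 𝒵) 𝒵 𝒵 ≤ projd 𝒳 𝒜 :=
  le_of_forall_le_natCast fun n hn => coresdimRel_le_iff.2 fun M hM =>
    ⟨n, le_rfl, h.nonempty_coresolution hA hX hM fun T hT k hk =>
      projd_le_iff.1 hn T hT k hk M (hX _ hM)⟩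

lemma projd_eq_coresdimRel (h : IsCompleteHereditaryPair 𝒳 𝒜 ℬ) (hA : 𝒜 ≤ 𝒵) (hX : 𝒵 ≤ 𝒳) :
    projd 𝒳 𝒜 = coresdimRel ℬ 𝒳 𝒵 := by
  have := h.isClosedUnderIsomorphisms
  have := h.isClosedUnderExtensions
  exact le_antisymm (h.projd_le_coresdimRel le_rfl hA)
    ((coresdimRel_le_coresdimRel inf_le_left le_rfl hX).trans
      (h.coresdimRel_inf_le_projd h.left_le le_rfl))

lemma projd_eq_coresdim_inf (h : IsCompleteHereditaryPair 𝒳 𝒜 ℬ) :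
    projd 𝒳 𝒜 = coresdim (𝒜 ⊓ ℬ) 𝒜 := by
  have := h.isClosedUnderIsomorphisms_left
  have := h.isClosedUnderExtensions_left
  exact le_antisymm (h.projd_le_coresdimRel inf_le_right le_rfl)
    ((coresdimRel_le_coresdimRel (inf_comm _ _).le le_top le_rfl).trans
      (h.coresdimRel_inf_le_projd le_rfl h.left_le))

lemma projd_eq_coresdim (h : IsCompleteHereditaryPair 𝒳 𝒜 ℬ) : projd 𝒳 𝒜 = coresdim ℬ 𝒜 :=
  le_antisymm (h.projd_le_coresdimRel le_rfl le_rfl)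
    ((coresdimRel_le_coresdimRel inf_le_right le_rfl le_rfl).trans h.projd_eq_coresdim_inf.ge)

lemma le_vee_inf_of_projd_lt_top (h : IsCompleteHereditaryPair 𝒳 𝒜 ℬ) (hf : projd 𝒜 𝒜 < ⊤) :
    𝒜 ≤ vee (𝒜 ⊓ ℬ) :=
  le_veeRel_of_coresdimRel_lt_top
    ((h.projd_eq_coresdim_inf.symm.trans h.projd_eq_projd_self).trans_lt hf)

lemma projd_eq_projd_inf (h : IsCompleteHereditaryPair 𝒳 𝒜 ℬ) (hA : 𝒜 ≤ vee (𝒜 ⊓ ℬ)) :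
    projd 𝒳 𝒜 = projd 𝒳 (𝒜 ⊓ ℬ) :=
  have := h.isClosedUnderIsomorphisms_left
  have := h.isClosedUnderIsomorphisms_right
  le_antisymm (projd_le_projd_of_le_veeRel hA) (projd_mono le_rfl inf_le_left)

lemma projd_lt_top_iff (h : IsCompleteHereditaryPair 𝒳 𝒜 ℬ) :
    projd 𝒜 𝒜 < ⊤ ↔ 𝒜 ≤ vee (𝒜 ⊓ ℬ) ∧ projd 𝒳 (𝒜 ⊓ ℬ) < ⊤ := by
  rw [← h.projd_eq_projd_self]
  refine ⟨fun hf => ?_, fun ⟨hA, hf⟩ => (h.projd_eq_projd_inf hA).trans_lt hf⟩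
  have hA := h.le_vee_inf_of_projd_lt_top (h.projd_eq_projd_self.ge.trans_lt hf)
  exact ⟨hA, (h.projd_eq_projd_inf hA).ge.trans_lt hf⟩

lemma le_pairVee_of_projd_lt_top (h : IsCompleteHereditaryPair 𝒳 𝒜 ℬ) (hf : projd 𝒜 𝒜 < ⊤) :
    𝒳 ≤ pairVee 𝒳 ℬ :=
  le_inf le_rfl <| le_veeRel_of_coresdimRel_lt_top <|
    ((h.projd_eq_coresdimRel h.left_le le_rfl).symm.trans h.projd_eq_projd_self).trans_lt hf

/-! ### The dual statements -/

lemma inf_eq_rightPerp_inf (h : IsCompleteHereditaryPair 𝒳 𝒜 ℬ) :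
    𝒜 ⊓ ℬ = rightPerp 𝒜 ⊓ 𝒜 := by
  simpa only [leftPerp_op, ← ObjectProperty.op_inf, ObjectProperty.op_injective_iff,
    inf_comm ℬ] using h.op.inf_eq_leftPerp_inf

lemma inf_eq_inf_wedgeRel (h : IsCompleteHereditaryPair 𝒳 𝒜 ℬ) [𝒵.IsClosedUnderIsomorphisms]
    (hZ : 𝒜 ≤ 𝒵) : 𝒜 ⊓ ℬ = 𝒜 ⊓ wedgeRel (𝒜 ⊓ ℬ) 𝒵 := by
  simpa only [veeRel_op, ← ObjectProperty.op_inf, ObjectProperty.op_injective_iff,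
    inf_comm ℬ] using h.op.inf_eq_inf_veeRel (ObjectProperty.op_monotone_iff.2 hZ)

lemma injd_eq_injd_self (h : IsCompleteHereditaryPair 𝒳 𝒜 ℬ) : injd 𝒳 ℬ = injd ℬ ℬ := by
  simpa only [projd_op] using h.op.projd_eq_projd_self

lemma injd_eq_resdimRel (h : IsCompleteHereditaryPair 𝒳 𝒜 ℬ) (hB : ℬ ≤ 𝒵) (hX : 𝒵 ≤ 𝒳) :
    injd 𝒳 ℬ = resdimRel 𝒜 𝒳 𝒵 := by
  have := h.isClosedUnderIsomorphisms
  simpa only [projd_op, coresdimRel_op] using h.op.projd_eq_coresdimRel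
    (ObjectProperty.op_monotone_iff.2 hB) (ObjectProperty.op_monotone_iff.2 hX)

lemma injd_eq_resdim_inf (h : IsCompleteHereditaryPair 𝒳 𝒜 ℬ) :
    injd 𝒳 ℬ = resdim (𝒜 ⊓ ℬ) ℬ := by
  simpa only [projd_op, coresdim_op, ← ObjectProperty.op_inf, inf_comm ℬ] using
    h.op.projd_eq_coresdim_inf

lemma injd_eq_resdim (h : IsCompleteHereditaryPair 𝒳 𝒜 ℬ) : injd 𝒳 ℬ = resdim 𝒜 ℬ := by
  simpa only [projd_op, coresdim_op] using h.op.projd_eq_coresdim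

lemma le_wedge_inf_of_injd_lt_top (h : IsCompleteHereditaryPair 𝒳 𝒜 ℬ) (hf : injd ℬ ℬ < ⊤) :
    ℬ ≤ wedge (𝒜 ⊓ ℬ) := by
  simpa only [vee_op, ← ObjectProperty.op_inf, ObjectProperty.op_monotone_iff, inf_comm ℬ] using
    h.op.le_vee_inf_of_projd_lt_top (projd_op.trans_lt hf)

lemma injd_eq_injd_inf (h : IsCompleteHereditaryPair 𝒳 𝒜 ℬ) (hB : ℬ ≤ wedge (𝒜 ⊓ ℬ)) :
    injd 𝒳 ℬ = injd 𝒳 (𝒜 ⊓ ℬ) := by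
  have := h.op.projd_eq_projd_inf
  simp only [projd_op, vee_op, ← ObjectProperty.op_inf, ObjectProperty.op_monotone_iff,
    inf_comm ℬ] at this
  exact this hB

lemma injd_lt_top_iff (h : IsCompleteHereditaryPair 𝒳 𝒜 ℬ) :
    injd ℬ ℬ < ⊤ ↔ ℬ ≤ wedge (𝒜 ⊓ ℬ) ∧ injd 𝒳 (𝒜 ⊓ ℬ) < ⊤ := by
  simpa only [projd_op, vee_op, ← ObjectProperty.op_inf, ObjectProperty.op_monotone_iff,
    inf_comm ℬ] using h.op.projd_lt_top_iff

lemma le_pairWedge_of_injd_lt_top (h : IsCompleteHereditaryPair 𝒳 𝒜 ℬ) (hf : injd ℬ ℬ < ⊤) :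
    𝒳 ≤ pairWedge 𝒜 𝒳 := by
  have := h.isClosedUnderIsomorphisms
  simpa only [pairVee_op, ObjectProperty.op_monotone_iff] using
    h.op.le_pairVee_of_projd_lt_top (projd_op.trans_lt hf)

end IsCompleteHereditaryPair

end RelHomAlg

open RelHomAlg in
theorem mainTheorem3_general {C : Type u} [Category.{v} C] [Abelian C]
    (𝒳 𝒜 ℬ ω : ObjectProperty C)
    [𝒳.IsClosedUnderIsomorphisms] [𝒳.IsClosedUnderExtensions]
    [𝒜.IsClosedUnderExtensions] [ℬ.IsClosedUnderExtensions]
    (hcomplete : IsComplete 𝒳 𝒜 ℬ) (hhereditary : IsHereditary 𝒳 𝒜 ℬ)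
    (hA : ClosedUnderSummands 𝒜) (hB : ClosedUnderSummands ℬ) (hω : ω = 𝒜 ⊓ ℬ ⊓ 𝒳) :
    (ω = rightPerp (𝒜 ⊓ 𝒳) ⊓ 𝒜 ⊓ 𝒳 ∧
      ω = 𝒜 ⊓ 𝒳 ⊓ wedge ω ∧
      ω = pairWedge ω (𝒜 ⊓ 𝒳)) ∧
    (projd 𝒳 (𝒜 ⊓ 𝒳) = projd (𝒜 ⊓ 𝒳) (𝒜 ⊓ 𝒳) ∧
      projd 𝒳 (𝒜 ⊓ 𝒳) = coresdim (ℬ ⊓ 𝒳) (𝒜 ⊓ 𝒳) ∧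
      projd 𝒳 (𝒜 ⊓ 𝒳) = coresdimRel ℬ 𝒳 𝒳 ∧
      projd 𝒳 (𝒜 ⊓ 𝒳) = coresdimRel ℬ 𝒳 (𝒜 ⊓ 𝒳) ∧
      projd 𝒳 (𝒜 ⊓ 𝒳) = coresdim ω (𝒜 ⊓ 𝒳) ∧
      projd 𝒳 (𝒜 ⊓ 𝒳) = coresdimRel (ℬ ⊓ 𝒳) 𝒳 (𝒜 ⊓ 𝒳) ∧
      projd 𝒳 (𝒜 ⊓ 𝒳) = coresdimRel (ℬ ⊓ 𝒳) 𝒳 𝒳) ∧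
    ((projd (𝒜 ⊓ 𝒳) (𝒜 ⊓ 𝒳) < ⊤ ↔
        𝒜 ⊓ 𝒳 ≤ vee ω ∧ projd 𝒳 ω < ⊤) ∧
      (projd (𝒜 ⊓ 𝒳) (𝒜 ⊓ 𝒳) < ⊤ →
        𝒳 ≤ pairVee 𝒳 ℬ ∧
        pairVee 𝒳 ℬ ≤ vee (ℬ ⊓ 𝒳) ∧
        projd 𝒳 (𝒜 ⊓ 𝒳) = projd 𝒳 ω)) ∧
    (ω = leftPerp (ℬ ⊓ 𝒳) ⊓ ℬ ⊓ 𝒳 ∧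
      ω = ℬ ⊓ 𝒳 ⊓ vee ω ∧
      ω = pairVee (ℬ ⊓ 𝒳) ω) ∧
    (injd 𝒳 (ℬ ⊓ 𝒳) = injd (ℬ ⊓ 𝒳) (ℬ ⊓ 𝒳) ∧
      injd 𝒳 (ℬ ⊓ 𝒳) = resdim (𝒜 ⊓ 𝒳) (ℬ ⊓ 𝒳) ∧
      injd 𝒳 (ℬ ⊓ 𝒳) = resdimRel 𝒜 𝒳 𝒳 ∧
      injd 𝒳 (ℬ ⊓ 𝒳) = resdimRel 𝒜 𝒳 (ℬ ⊓ 𝒳) ∧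
      injd 𝒳 (ℬ ⊓ 𝒳) = resdim ω (ℬ ⊓ 𝒳) ∧
      injd 𝒳 (ℬ ⊓ 𝒳) = resdimRel (𝒜 ⊓ 𝒳) 𝒳 (ℬ ⊓ 𝒳) ∧
      injd 𝒳 (ℬ ⊓ 𝒳) = resdimRel (𝒜 ⊓ 𝒳) 𝒳 𝒳) ∧
    ((injd (ℬ ⊓ 𝒳) (ℬ ⊓ 𝒳) < ⊤ ↔
        ℬ ⊓ 𝒳 ≤ wedge ω ∧ injd 𝒳 ω < ⊤) ∧
      (injd (ℬ ⊓ 𝒳) (ℬ ⊓ 𝒳) < ⊤ →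
        𝒳 ≤ pairWedge 𝒜 𝒳 ∧
        pairWedge 𝒜 𝒳 ≤ wedge (𝒜 ⊓ 𝒳) ∧
        injd 𝒳 (ℬ ⊓ 𝒳) = injd 𝒳 ω)) := by
  have h := hcomplete.isCompleteHereditaryPair hhereditary hA hB
  have := hA.isClosedUnderIsomorphisms
  have := hB.isClosedUnderIsomorphisms
  obtain rfl : ω = (𝒜 ⊓ 𝒳) ⊓ (ℬ ⊓ 𝒳) := hω.trans (inf_inf_distrib_right _ _ _)
  have hAX : 𝒜 ⊓ 𝒳 ≤ 𝒳 := inf_le_right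
  have hBX : ℬ ⊓ 𝒳 ≤ 𝒳 := inf_le_right
  rw [← coresdimRel_inf (𝒴 := ℬ) le_rfl, ← coresdimRel_inf (𝒴 := ℬ) hAX, ← pairVee_inf (𝒴 := ℬ),
    ← resdimRel_inf (𝒴 := 𝒜) le_rfl, ← resdimRel_inf (𝒴 := 𝒜) hBX, ← pairWedge_inf (𝒴 := 𝒜),
    inf_assoc (rightPerp _), inf_assoc (leftPerp _)]
  have projd_eq_𝒳 := h.projd_eq_coresdimRel hAX le_rfl
  have projd_eq_𝒜 := h.projd_eq_coresdimRel le_rfl hAX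
  have injd_eq_𝒳 := h.injd_eq_resdimRel hBX le_rfl
  have injd_eq_ℬ := h.injd_eq_resdimRel le_rfl hBX
  exact ⟨⟨h.inf_eq_rightPerp_inf, h.inf_eq_inf_wedgeRel le_top,
      (h.inf_eq_inf_wedgeRel le_rfl).trans (inf_comm _ _)⟩,
    ⟨h.projd_eq_projd_self, h.projd_eq_coresdim, projd_eq_𝒳, projd_eq_𝒜,
      h.projd_eq_coresdim_inf, projd_eq_𝒜, projd_eq_𝒳⟩,
    ⟨h.projd_lt_top_iff, fun hf => ⟨h.le_pairVee_of_projd_lt_top hf, pairVee_le_vee,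
      h.projd_eq_projd_inf (h.le_vee_inf_of_projd_lt_top hf)⟩⟩,
    ⟨h.inf_eq_leftPerp_inf, h.inf_eq_inf_veeRel le_top, h.inf_eq_inf_veeRel le_rfl⟩,
    ⟨h.injd_eq_injd_self, h.injd_eq_resdim, injd_eq_𝒳, injd_eq_ℬ,
      h.injd_eq_resdim_inf, injd_eq_ℬ, injd_eq_𝒳⟩,
    ⟨h.injd_lt_top_iff, fun hf => ⟨h.le_pairWedge_of_injd_lt_top hf, pairWedge_le_wedge,
      h.injd_eq_injd_inf (h.le_wedge_inf_of_injd_lt_top hf)⟩⟩⟩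

theorem mainTheorem3 {C : Type u} [Category.{v} C] [Abelian C]
    (𝒳 𝒜 ℬ ω : ObjectProperty C)
    (hcomplete : RelHomAlg.IsComplete 𝒳 𝒜 ℬ)
    (hhereditary : RelHomAlg.IsHereditary 𝒳 𝒜 ℬ)
    (hAext : 𝒜.IsClosedUnderExtensions)
    (hXext : 𝒳.IsClosedUnderExtensions)
    (hBext : ℬ.IsClosedUnderExtensions)
    (hAsmd : RelHomAlg.ClosedUnderSummands 𝒜)
    (hXsmd : RelHomAlg.ClosedUnderSummands 𝒳)
    (hBsmd : RelHomAlg.ClosedUnderSummands ℬ)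
    (hω : ω = 𝒜 ⊓ ℬ ⊓ 𝒳) :
    -- (a)
    (ω = RelHomAlg.rightPerp (𝒜 ⊓ 𝒳) ⊓ 𝒜 ⊓ 𝒳 ∧
      ω = 𝒜 ⊓ 𝒳 ⊓ RelHomAlg.wedge ω ∧
      ω = RelHomAlg.pairWedge ω (𝒜 ⊓ 𝒳)) ∧
    -- (a1)
    (RelHomAlg.projd 𝒳 (𝒜 ⊓ 𝒳) = RelHomAlg.projd (𝒜 ⊓ 𝒳) (𝒜 ⊓ 𝒳) ∧
      RelHomAlg.projd 𝒳 (𝒜 ⊓ 𝒳) = RelHomAlg.coresdim (ℬ ⊓ 𝒳) (𝒜 ⊓ 𝒳) ∧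
      RelHomAlg.projd 𝒳 (𝒜 ⊓ 𝒳) = RelHomAlg.coresdimRel ℬ 𝒳 𝒳 ∧
      RelHomAlg.projd 𝒳 (𝒜 ⊓ 𝒳) = RelHomAlg.coresdimRel ℬ 𝒳 (𝒜 ⊓ 𝒳) ∧
      RelHomAlg.projd 𝒳 (𝒜 ⊓ 𝒳) = RelHomAlg.coresdim ω (𝒜 ⊓ 𝒳) ∧
      RelHomAlg.projd 𝒳 (𝒜 ⊓ 𝒳) = RelHomAlg.coresdimRel (ℬ ⊓ 𝒳) 𝒳 (𝒜 ⊓ 𝒳) ∧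
      RelHomAlg.projd 𝒳 (𝒜 ⊓ 𝒳) = RelHomAlg.coresdimRel (ℬ ⊓ 𝒳) 𝒳 𝒳) ∧
    -- (a2)
    ((RelHomAlg.projd (𝒜 ⊓ 𝒳) (𝒜 ⊓ 𝒳) < ⊤ ↔
        𝒜 ⊓ 𝒳 ≤ RelHomAlg.vee ω ∧ RelHomAlg.projd 𝒳 ω < ⊤) ∧
      (RelHomAlg.projd (𝒜 ⊓ 𝒳) (𝒜 ⊓ 𝒳) < ⊤ →
        𝒳 ≤ RelHomAlg.pairVee 𝒳 ℬ ∧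
        RelHomAlg.pairVee 𝒳 ℬ ≤ RelHomAlg.vee (ℬ ⊓ 𝒳) ∧
        RelHomAlg.projd 𝒳 (𝒜 ⊓ 𝒳) = RelHomAlg.projd 𝒳 ω)) ∧
    -- (b)
    (ω = RelHomAlg.leftPerp (ℬ ⊓ 𝒳) ⊓ ℬ ⊓ 𝒳 ∧
      ω = ℬ ⊓ 𝒳 ⊓ RelHomAlg.vee ω ∧
      ω = RelHomAlg.pairVee (ℬ ⊓ 𝒳) ω) ∧
    -- (b1)
    (RelHomAlg.injd 𝒳 (ℬ ⊓ 𝒳) = RelHomAlg.injd (ℬ ⊓ 𝒳) (ℬ ⊓ 𝒳) ∧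
      RelHomAlg.injd 𝒳 (ℬ ⊓ 𝒳) = RelHomAlg.resdim (𝒜 ⊓ 𝒳) (ℬ ⊓ 𝒳) ∧
      RelHomAlg.injd 𝒳 (ℬ ⊓ 𝒳) = RelHomAlg.resdimRel 𝒜 𝒳 𝒳 ∧
      RelHomAlg.injd 𝒳 (ℬ ⊓ 𝒳) = RelHomAlg.resdimRel 𝒜 𝒳 (ℬ ⊓ 𝒳) ∧
      RelHomAlg.injd 𝒳 (ℬ ⊓ 𝒳) = RelHomAlg.resdim ω (ℬ ⊓ 𝒳) ∧
      RelHomAlg.injd 𝒳 (ℬ ⊓ 𝒳) = RelHomAlg.resdimRel (𝒜 ⊓ 𝒳) 𝒳 (ℬ ⊓ 𝒳) ∧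
      RelHomAlg.injd 𝒳 (ℬ ⊓ 𝒳) = RelHomAlg.resdimRel (𝒜 ⊓ 𝒳) 𝒳 𝒳) ∧
    -- (b2)
    ((RelHomAlg.injd (ℬ ⊓ 𝒳) (ℬ ⊓ 𝒳) < ⊤ ↔
        ℬ ⊓ 𝒳 ≤ RelHomAlg.wedge ω ∧ RelHomAlg.injd 𝒳 ω < ⊤) ∧
      (RelHomAlg.injd (ℬ ⊓ 𝒳) (ℬ ⊓ 𝒳) < ⊤ →
        𝒳 ≤ RelHomAlg.pairWedge 𝒜 𝒳 ∧
        RelHomAlg.pairWedge 𝒜 𝒳 ≤ RelHomAlg.wedge (𝒜 ⊓ 𝒳) ∧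
        RelHomAlg.injd 𝒳 (ℬ ⊓ 𝒳) = RelHomAlg.injd 𝒳 ω)) := by
  have := hXsmd.isClosedUnderIsomorphisms
  exact mainTheorem3_general 𝒳 𝒜 ℬ ω hcomplete hhereditary hAsmd hBsmd hω
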